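/- Let $X\neq\{0\}$ be a real or complex Banach space with topological dual $X^*$ and bidual $X^{**}$, let $B_X$ denote the closed unit ball of a normed space and $L(X)$ the algebra of bounded linear operators on $X$. Assume that $X$ is an Asplund space, i.e. every continuous convex real-valued function on a nonempty open convex subset $D$ of (the real space underlying) $X$ is Fréchet differentiable at every point of some dense $G_\delta$ subset of $D$. Then the following three conditions are equivalent. (i) $n(X)=1$, where $n(X)=\max\{k\ge 0 : k\|T\|\le v(T)\text{ for all }T\in L(X)\}$ is the numerical index of $X$ and $v(T)=\sup\{|x^*(Tx)| : x\in X,\ x^*\in X^*,\ \|x^*\|=\|x\|=x^*(x)=1\}$ is the numerical radius of $T$. (ii) $X$ has the alternative Daugavet property: $\max_{|\omega|=1}\|\mathrm{Id}+\omega T\|=1+\|T\|$ for every rank-one operator $T\in L(X)$. (iii) $|x^{**}(x^*)|=1$ for every extreme point $x^{**}$ of $B_{X^{**}}$ and every $w^*$-strongly exposed point $x^*$ of $B_{X^*}$. Here $x^*\in X^*$ with $\|x^*\|=1$ is called a $w^*$-strongly exposed point of $B_{X^*}$ if there is $u\in B_X$ with $x^*(u)=1$ such that $\|x_n^*-x^*\|\to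 0$ for every sequence $(x_n^*)$ in $B_{X^*}$ with $\operatorname{Re}x_n^*(u)\to 1$. -/

import Mathlib

open Filter Topology Metric

/-- The numerical radius
`v(T) = sup {|x*(T x)| : x ∈ X, x* ∈ X*, ‖x*‖ = ‖x‖ = x*(x) = 1}` of a bounded operator `T`. -/
noncomputable def numericalRadius {𝕜 X : Type*} [RCLike 𝕜] [NormedAddCommGroup X]
    [NormedSpace 𝕜 X] (T : X →L[𝕜] X) : ℝ :=
  sSup {r : ℝ | ∃ (x : X) (f : StrongDual 𝕜 X), ‖f‖ = 1 ∧ ‖x‖ = 1 ∧ f x = 1 ∧ r = ‖f (T x)‖}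

/-- The numerical index `n(X)`: the largest `k ≥ 0` such that `k ‖T‖ ≤ v(T)` for all bounded
operators `T`. For `X ≠ 0` the supremum is attained, see `isGreatest_numericalIndex`. -/
noncomputable def numericalIndex (𝕜 X : Type*) [RCLike 𝕜] [NormedAddCommGroup X]
    [NormedSpace 𝕜 X] : ℝ :=
  sSup {k : ℝ | 0 ≤ k ∧ ∀ T : X →L[𝕜] X, k * ‖T‖ ≤ numericalRadius T}

theorem numericalRadius_nonneg {𝕜 X : Type*} [RCLike 𝕜] [NormedAddCommGroup X]
    [NormedSpace 𝕜 X] (T : X →L[𝕜] X) : 0 ≤ numericalRadius T := by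
  apply Real.sSup_nonneg
  rintro r ⟨x, f, -, -, -, rfl⟩
  exact norm_nonneg _

theorem numericalRadius_le_norm {𝕜 X : Type*} [RCLike 𝕜] [NormedAddCommGroup X]
    [NormedSpace 𝕜 X] (T : X →L[𝕜] X) : numericalRadius T ≤ ‖T‖ := by
  apply Real.sSup_le _ (norm_nonneg T)
  rintro r ⟨x, f, hf, hx, -, rfl⟩
  calc ‖f (T x)‖ ≤ ‖f‖ * ‖T x‖ := f.le_opNorm _
    _ ≤ 1 * (‖T‖ * ‖x‖) := by rw [hf]; gcongr; exact T.le_opNorm x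
    _ = ‖T‖ := by rw [hx]; ring

theorem isGreatest_numericalIndex (𝕜 X : Type*) [RCLike 𝕜] [NormedAddCommGroup X]
    [NormedSpace 𝕜 X] [Nontrivial X] :
    IsGreatest {k : ℝ | 0 ≤ k ∧ ∀ T : X →L[𝕜] X, k * ‖T‖ ≤ numericalRadius T}
      (numericalIndex 𝕜 X) := by
  have hne : {k : ℝ | 0 ≤ k ∧ ∀ T : X →L[𝕜] X, k * ‖T‖ ≤ numericalRadius T}.Nonempty :=
    ⟨0, le_rfl, fun T => by simpa using numericalRadius_nonneg T⟩
  have hbdd : BddAbove {k : ℝ | 0 ≤ k ∧ ∀ T : X →L[𝕜] X, k * ‖T‖ ≤ numericalRadius T} := by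
    refine ⟨1, ?_⟩
    rintro k ⟨-, hk⟩
    have h := (hk (ContinuousLinearMap.id 𝕜 X)).trans (numericalRadius_le_norm _)
    simpa [ContinuousLinearMap.norm_id] using h
  have hclosed : IsClosed {k : ℝ | 0 ≤ k ∧ ∀ T : X →L[𝕜] X, k * ‖T‖ ≤ numericalRadius T} := by
    simp only [Set.ofPred_and, Set.ofPred_forall]
    exact isClosed_Ici.inter
      (isClosed_iInter fun T => isClosed_le (by fun_prop) continuous_const)
  exact ⟨hclosed.csSup_mem hne hbdd, fun k hk => le_csSup hbdd hk⟩

/-- The alternative Daugavet property: every rank-one bounded operator `T` on `X` satisfies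
`max {‖Id + ω T‖ : |ω| = 1} = 1 + ‖T‖`. -/
def HasAlternativeDaugavetProperty (𝕜 X : Type*) [RCLike 𝕜] [NormedAddCommGroup X]
    [NormedSpace 𝕜 X] : Prop :=
  ∀ T : X →L[𝕜] X, Module.finrank 𝕜 (LinearMap.range (T : X →ₗ[𝕜] X)) = 1 →
    IsGreatest ((fun ω : 𝕜 => ‖ContinuousLinearMap.id 𝕜 X + ω • T‖) '' sphere (0 : 𝕜) 1)
      (1 + ‖T‖)

/-- `f` is a `w*`-strongly exposed point of the closed unit ball of the dual of `X`: it has norm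
one and there is `u` in the unit ball of `X` with `f u = 1` such that every sequence `g n` in the
dual unit ball with `Re (g n u) → 1` converges to `f` in norm. -/
def IsWeakStarStronglyExposed {𝕜 X : Type*} [RCLike 𝕜] [NormedAddCommGroup X]
    [NormedSpace 𝕜 X] (f : StrongDual 𝕜 X) : Prop :=
  ‖f‖ = 1 ∧ ∃ u : X, ‖u‖ ≤ 1 ∧ f u = 1 ∧
    ∀ g : ℕ → StrongDual 𝕜 X, (∀ n, ‖g n‖ ≤ 1) →
      Tendsto (fun n => RCLike.re (g n u)) atTop (𝓝 1) →
      Tendsto (fun n => ‖g n - f‖) atTop (𝓝 0)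

/-- A Banach space is an Asplund space if every continuous convex real-valued function on a
nonempty open convex subset `D` is Fréchet differentiable at each point of some dense `G_δ` subset
of `D`. For a complex space, this refers to the underlying real space. -/
def IsAsplundSpace (X : Type*) [NormedAddCommGroup X] [NormedSpace ℝ X] : Prop :=
  ∀ D : Set X, IsOpen D → D.Nonempty → ∀ φ : X → ℝ, ConvexOn ℝ D φ → ContinuousOn φ D →
    ∃ G : Set X, G ⊆ D ∧ IsGδ G ∧ D ⊆ closure G ∧ ∀ x ∈ G, DifferentiableAt ℝ φ x

open Filter Topology Metric

/-! (i) ⇒ (ii): rotating `T` turns a large `|f (T x)|` into a large `‖Id + ω T‖`.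

(ii) ⇒ (iii): if `u` strongly exposes `f`, the property for `g ⊗ u` gives `‖f + ω g‖ = 1 + ‖g‖` for
every `g`. So the functionals of modulus one at `f` norm `X*`, and Milman's theorem for finitely
many `w*`-compact slices puts every extreme point among those of modulus at least `r`, for each `r <
1`.

(iii) ⇒ (i): by Šmulian's test the strongly exposed functionals norm an Asplund space. For such `f`,
an extreme `F` norms `f ∘ T` and has `|F f| = 1`; Lumer's estimate bounds `|F (f ∘ T)|` by `v(T)`,
so `‖f ∘ T‖ ≤ v(T)`. -/

/-! ### Compact convex hulls. -/

theorem isCompact_convexJoin {E : Type*} [AddCommGroup E] [Module ℝ E] [TopologicalSpace E]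
    [ContinuousAdd E] [ContinuousSMul ℝ E] {s t : Set E} (hs : IsCompact s) (ht : IsCompact t) :
    IsCompact (convexJoin ℝ s t) := by
  have h : convexJoin ℝ s t =
      (fun p : (E × E) × ℝ => (1 - p.2) • p.1.1 + p.2 • p.1.2) '' ((s ×ˢ t) ×ˢ Set.Icc 0 1) := by
    ext z
    simp only [mem_convexJoin, segment_eq_image, Set.mem_image, Set.mem_prod, Prod.exists]
    constructor
    · rintro ⟨x, hx, y, hy, r, hr, rfl⟩
      exact ⟨x, y, r, ⟨⟨hx, hy⟩, hr⟩, rfl⟩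
    · rintro ⟨x, y, r, ⟨⟨hx, hy⟩, hr⟩, rfl⟩
      exact ⟨x, hx, y, hy, r, hr, rfl⟩
  rw [h]
  exact ((hs.prod ht).prod isCompact_Icc).image (by fun_prop)

/-- Adding one convex piece is a convex join, so no closure of the hull is needed. -/
theorem isCompact_convexHull_biUnion {E ι : Type*} [AddCommGroup E] [Module ℝ E]
    [TopologicalSpace E] [ContinuousAdd E] [ContinuousSMul ℝ E] (C : ι → Set E)
    (hC : ∀ i, IsCompact (C i)) (hconv : ∀ i, Convex ℝ (C i)) (J : Finset ι) :
    IsCompact (convexHull ℝ (⋃ i ∈ J, C i)) := by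
  classical
  induction J using Finset.induction_on with
  | empty => simp
  | insert i J _ ih =>
    rw [Finset.set_biUnion_insert]
    rcases (C i).eq_empty_or_nonempty with h | h
    · rwa [h, Set.empty_union]
    rcases (⋃ j ∈ J, C j).eq_empty_or_nonempty with h' | h'
    · rw [h', Set.union_empty, (hconv i).convexHull_eq]
      exact hC i
    · rw [convexHull_union h h', (hconv i).convexHull_eq]
      exact isCompact_convexJoin (hC i) ih

/-! ### The `w*`-topology and extreme points of dual balls. -/

section
variable {𝕜 Y : Type*} [RCLike 𝕜] [NormedAddCommGroup Y] [NormedSpace 𝕜 Y]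

/-- Extreme points, hulls and geometric Hahn–Banach are taken over `ℝ`, also when `𝕜` is complex. -/
noncomputable instance WeakDual.instModuleReal : Module ℝ (WeakDual 𝕜 Y) :=
  WeakDual.instModule' ℝ

noncomputable instance WeakDual.instSMulReal : SMul ℝ (WeakDual 𝕜 Y) :=
  WeakDual.instModuleReal.toDistribMulAction.toDistribSMul.toSMul

instance WeakDual.instContinuousSMulReal : ContinuousSMul ℝ (WeakDual 𝕜 Y) :=
  WeakDual.instContinuousSMul ℝ

instance WeakDual.isScalarTower_real : IsScalarTower ℝ 𝕜 (WeakDual 𝕜 Y) :=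
  inferInstanceAs (IsScalarTower ℝ 𝕜 (Y →L[𝕜] 𝕜))

instance WeakDual.locallyConvexSpace_real : LocallyConvexSpace ℝ (WeakDual 𝕜 Y) :=
  inferInstanceAs (LocallyConvexSpace ℝ (WeakBilin (topDualPairing 𝕜 Y)))

theorem WeakDual.exists_eq_eval (l : StrongDual 𝕜 (WeakDual 𝕜 Y)) :
    ∃ g : Y, ∀ G : WeakDual 𝕜 Y, l G = G g := by
  obtain ⟨g, hg⟩ := LinearMap.dualEmbedding_surjective (topDualPairing 𝕜 Y) l
  exact ⟨g, fun G => (DFunLike.congr_fun hg G).symm⟩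

theorem WeakDual.exists_real_separating {C : Set (WeakDual 𝕜 Y)} {F : WeakDual 𝕜 Y}
    (hC : Convex ℝ C) (hC' : IsClosed C) (hF : F ∉ C) :
    ∃ (l : StrongDual ℝ (WeakDual 𝕜 Y)) (u : ℝ), (∀ G ∈ C, l G < u) ∧ u < l F :=
  geometric_hahn_banach_closed_point hC hC' hF

/-- A point outside a `w*`-closed convex set is separated from it by an element of the predual. -/
theorem WeakDual.exists_separating {C : Set (WeakDual 𝕜 Y)} {F : WeakDual 𝕜 Y}
    (hC : Convex ℝ C) (hC' : IsClosed C) (hF : F ∉ C) :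
    ∃ (g : Y) (u : ℝ), (∀ G ∈ C, RCLike.re (G g) < u) ∧ u < RCLike.re (F g) := by
  obtain ⟨l, u, hl, hu⟩ := WeakDual.exists_real_separating hC hC' hF
  -- A real functional is the real part of a `𝕜`-linear one, which by `w*`-continuity is an
  -- evaluation.
  let L : StrongDual 𝕜 (WeakDual 𝕜 Y) := l.extendRCLikeₗ
  have hL : ∀ G, RCLike.re (L G) = l G := fun G => by simp [L, l.extendRCLikeₗ_apply]
  obtain ⟨g, hg⟩ := WeakDual.exists_eq_eval L
  refine ⟨g, u, fun G hG => ?_, ?_⟩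
  · rw [← hg, hL]
    exact hl G hG
  · rw [← hg, hL]
    exact hu

theorem mem_extremePoints_toWeakDual_iff (F : WeakDual 𝕜 Y) :
    F ∈ (WeakDual.toStrongDual ⁻¹' closedBall (0 : StrongDual 𝕜 Y) 1).extremePoints ℝ ↔
      WeakDual.toStrongDual F ∈ (closedBall (0 : StrongDual 𝕜 Y) 1).extremePoints ℝ :=
  Iff.rfl

theorem convex_weakDual_ball :
    Convex ℝ (WeakDual.toStrongDual ⁻¹' closedBall (0 : StrongDual 𝕜 Y) 1) :=
  convex_closedBall (0 : StrongDual 𝕜 Y) 1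

/-- The real part of evaluation at `y`, as a `w*`-continuous real functional on the dual. -/
noncomputable def WeakDual.reEval (y : Y) : StrongDual ℝ (WeakDual 𝕜 Y) where
  toFun F := RCLike.re (F y)
  map_add' F G := map_add RCLike.re (F y) (G y)
  map_smul' r F := RCLike.smul_re r (F y)
  cont := RCLike.continuous_re.comp (WeakDual.eval_continuous y)

theorem StrongDual.re_apply_le_norm {F : StrongDual 𝕜 Y} (hF : ‖F‖ ≤ 1) (y : Y) :
    RCLike.re (F y) ≤ ‖y‖ :=
  (RCLike.re_le_norm _).trans (F.le_of_opNorm_le_of_le hF le_rfl |>.trans_eq (one_mul _))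

/-- Every vector of a normed space is normed by an extreme point of the dual unit ball. -/
theorem exists_extremePoint_re_apply_eq_norm (y : Y) :
    ∃ F ∈ (closedBall (0 : StrongDual 𝕜 Y) 1).extremePoints ℝ, RCLike.re (F y) = ‖y‖ := by
  obtain ⟨G, hG, hGy⟩ := exists_dual_vector'' 𝕜 y
  set B := WeakDual.toStrongDual ⁻¹' closedBall (0 : StrongDual 𝕜 Y) 1
  have hcomp : IsCompact B := WeakDual.isCompact_closedBall (0 : StrongDual 𝕜 Y) 1
  -- The functionals norming `y` form a nonempty compact face; its extreme points are extreme in the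
  -- ball.
  have h : IsExposed ℝ B {F ∈ B | ∀ H ∈ B, WeakDual.reEval y H ≤ WeakDual.reEval y F} :=
    fun _ => ⟨WeakDual.reEval y, rfl⟩
  have hGB : StrongDual.toWeakDual G ∈ B := mem_closedBall_zero_iff.2 hG
  have hGy' : WeakDual.reEval y (StrongDual.toWeakDual G) = ‖y‖ := by
    change RCLike.re (G y) = ‖y‖
    rw [hGy, RCLike.ofReal_re]
  obtain ⟨F, hF⟩ := (h.isCompact hcomp).extremePoints_nonempty
    ⟨StrongDual.toWeakDual G, hGB, fun H hH => hGy'.symm ▸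
      StrongDual.re_apply_le_norm (mem_closedBall_zero_iff.1 hH) y⟩
  have hFB := h.isExtreme.extremePoints_subset_extremePoints hF
  refine ⟨WeakDual.toStrongDual F, (mem_extremePoints_toWeakDual_iff F).1 hFB, le_antisymm
    (StrongDual.re_apply_le_norm (mem_closedBall_zero_iff.1 hFB.1) y) ?_⟩
  rw [← hGy']
  exact hF.1.2 _ hGB

/-- Makes the set of functionals of modulus one at `f` fit into finitely many convex slices. -/
theorem exists_finset_sphere_lt_re_mul (𝕜 : Type*) [RCLike 𝕜] {r : ℝ} (hr : r < 1) :
    ∃ J : Finset 𝕜, (∀ w ∈ J, ‖w‖ = 1) ∧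
      ∀ z : 𝕜, ‖z‖ = 1 → ∃ w ∈ J, r < RCLike.re (w * z) := by
  obtain ⟨J, hJ, hcov⟩ := (isCompact_sphere (0 : 𝕜) 1).elim_nhds_subcover
    (fun w => {z | r < RCLike.re (starRingEnd 𝕜 w * z)}) (fun w hw => by
      refine (isOpen_lt continuous_const (by fun_prop)).mem_nhds ?_
      have : ‖w‖ = 1 := by simpa using hw
      change r < RCLike.re (starRingEnd 𝕜 w * w)
      rw [RCLike.conj_mul, this]
      simpa using hr)
  classical
  refine ⟨J.image (starRingEnd 𝕜), ?_, fun z hz => ?_⟩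
  · intro w hw
    obtain ⟨v, hv, rfl⟩ := Finset.mem_image.1 hw
    simpa using hJ v hv
  · obtain ⟨w, hw, h⟩ := Set.mem_iUnion₂.1 (hcov (show z ∈ sphere (0 : 𝕜) 1 by simpa using hz))
    exact ⟨_, Finset.mem_image_of_mem _ hw, h⟩

/-- If `‖f‖ = 1` and `‖f + ω g‖ ≥ 1 + ‖g‖` with `|ω| = 1`, a functional in the dual unit ball norms
`g` and has modulus one at `f`. -/
theorem exists_dual_re_apply_eq_norm {f g : Y} (hf : ‖f‖ = 1)
    (h : ∃ ω : 𝕜, ‖ω‖ = 1 ∧ 1 + ‖g‖ ≤ ‖f + ω • g‖) :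
    ∃ G : StrongDual 𝕜 Y, ‖G‖ ≤ 1 ∧ ‖G f‖ = 1 ∧ RCLike.re (G g) = ‖g‖ := by
  obtain ⟨ω, hω, hωg⟩ := h
  obtain ⟨G, hG, hGe⟩ := exists_dual_vector'' 𝕜 (f + ω • g)
  have hle : ∀ y, ‖G y‖ ≤ ‖y‖ := fun y =>
    (G.le_of_opNorm_le_of_le hG le_rfl).trans_eq (one_mul _)
  have hre : RCLike.re (G f) + RCLike.re (ω * G g) = ‖f + ω • g‖ := by
    rw [← map_add, ← smul_eq_mul, ← map_smul, ← map_add, hGe, RCLike.ofReal_re]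
  -- The two terms are at most `1` and `‖g‖` but sum to at least `1 + ‖g‖`, so both bounds are
  -- attained.
  have h1 := RCLike.re_le_norm (G f)
  have h2 := RCLike.re_le_norm (ω * G g)
  have h3 := hle f
  have h4 := hle g
  rw [norm_mul, hω, one_mul] at h2
  rw [hf] at h3
  refine ⟨ω • G, ?_, ?_, ?_⟩
  · rwa [norm_smul, hω, one_mul]
  · rw [smul_apply, norm_smul, hω, one_mul]
    linarith
  · rw [smul_apply, smul_eq_mul]
    linarith

theorem convex_weakDual_slice (y : Y) (r : ℝ) :
    Convex ℝ ((WeakDual.toStrongDual ⁻¹' closedBall (0 : StrongDual 𝕜 Y) 1) ∩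
      {G | r ≤ WeakDual.reEval y G}) :=
  convex_weakDual_ball.inter (convex_halfSpace_ge (WeakDual.reEval y).isLinear r)

theorem isCompact_weakDual_slice (y : Y) (r : ℝ) :
    IsCompact ((WeakDual.toStrongDual ⁻¹' closedBall (0 : StrongDual 𝕜 Y) 1) ∩
      {G | r ≤ WeakDual.reEval y G}) :=
  (WeakDual.isCompact_closedBall (0 : StrongDual 𝕜 Y) 1).inter_right
    (isClosed_le continuous_const (WeakDual.reEval y).continuous)

/-- A form of Milman's theorem: extreme points of the dual ball belong to the union of any finite
family of `w*`-compact convex subsets whose union norms the space. -/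
theorem exists_mem_of_mem_extremePoints {ι : Type*} (C : ι → Set (WeakDual 𝕜 Y))
    (hC : ∀ i, IsCompact (C i)) (hconv : ∀ i, Convex ℝ (C i)) (J : Finset ι)
    (hCB : ∀ i, C i ⊆ WeakDual.toStrongDual ⁻¹' closedBall (0 : StrongDual 𝕜 Y) 1)
    (hnorm : ∀ g : Y, ∃ i ∈ J, ∃ G ∈ C i, ‖g‖ ≤ RCLike.re (G g)) {F : StrongDual 𝕜 Y}
    (hF : F ∈ (closedBall (0 : StrongDual 𝕜 Y) 1).extremePoints ℝ) :
    ∃ i ∈ J, StrongDual.toWeakDual F ∈ C i := by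
  have hK : IsCompact (convexHull ℝ (⋃ i ∈ J, C i)) :=
    isCompact_convexHull_biUnion C hC hconv J
  have hKB : convexHull ℝ (⋃ i ∈ J, C i) ⊆
      WeakDual.toStrongDual ⁻¹' closedBall (0 : StrongDual 𝕜 Y) 1 :=
    convexHull_min (Set.iUnion₂_subset fun i _ => hCB i) convex_weakDual_ball
  -- A separating `g` would have `Re G g < Re F g ≤ ‖g‖` for every `G` in the union, which norms
  -- `g`.
  have hmem : StrongDual.toWeakDual F ∈ convexHull ℝ (⋃ i ∈ J, C i) := by
    by_contra hnot
    obtain ⟨g, s, hl, hs⟩ := WeakDual.exists_separating (convex_convexHull ℝ _) hK.isClosed hnot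
    obtain ⟨i, hi, G, hG, hGg⟩ := hnorm g
    have h1 : RCLike.re (G g) < s := hl G (subset_convexHull ℝ _ (Set.mem_biUnion hi hG))
    have h2 : s < RCLike.re (F g) := hs
    linarith [StrongDual.re_apply_le_norm (mem_closedBall_zero_iff.1 hF.1) g]
  have hFext : StrongDual.toWeakDual F ∈ (convexHull ℝ (⋃ i ∈ J, C i)).extremePoints ℝ :=
    inter_extremePoints_subset_extremePoints_of_subset hKB
      ⟨hmem, (mem_extremePoints_toWeakDual_iff _).2 hF⟩
  obtain ⟨i, hi, h⟩ := Set.mem_iUnion₂.1 (extremePoints_convexHull_subset hFext)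
  exact ⟨i, hi, h⟩

/-- If every vector `g` satisfies `‖f + ω g‖ ≥ 1 + ‖g‖` for some unimodular `ω`, then every
extreme point of the dual ball has modulus one at `f`. -/
theorem norm_apply_eq_one_of_mem_extremePoints {f : Y} (hf : ‖f‖ = 1)
    (h : ∀ g : Y, ∃ ω : 𝕜, ‖ω‖ = 1 ∧ 1 + ‖g‖ ≤ ‖f + ω • g‖) {F : StrongDual 𝕜 Y}
    (hF : F ∈ (closedBall (0 : StrongDual 𝕜 Y) 1).extremePoints ℝ) : ‖F f‖ = 1 := by
  have hle : ‖F f‖ ≤ 1 := hf ▸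
    (F.le_of_opNorm_le_of_le (mem_closedBall_zero_iff.1 hF.1) le_rfl).trans_eq (one_mul _)
  by_contra hne
  obtain ⟨r, hr, hr1⟩ := exists_between (lt_of_le_of_ne hle hne)
  obtain ⟨J, hJ, hcov⟩ := exists_finset_sphere_lt_re_mul 𝕜 hr1
  obtain ⟨w, hw, -, hwF⟩ := exists_mem_of_mem_extremePoints
    (fun w : 𝕜 => (WeakDual.toStrongDual ⁻¹' closedBall (0 : StrongDual 𝕜 Y) 1) ∩
      {G | r ≤ WeakDual.reEval (w • f) G}) (fun w => isCompact_weakDual_slice _ _)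
    (fun w => convex_weakDual_slice _ _) J (fun w => Set.inter_subset_left) (fun g => by
      obtain ⟨G, hG, hGf, hGg⟩ := exists_dual_re_apply_eq_norm hf (h g)
      obtain ⟨w, hw, hwG⟩ := hcov (G f) hGf
      refine ⟨w, hw, StrongDual.toWeakDual G, ⟨mem_closedBall_zero_iff.2 hG, ?_⟩, hGg.ge⟩
      change r ≤ RCLike.re (G (w • f))
      rw [map_smul]
      exact hwG.le) hF
  have : RCLike.re (F (w • f)) ≤ ‖F f‖ := (RCLike.re_le_norm _).trans (by
    rw [map_smul, norm_smul, hJ w hw, one_mul])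
  exact absurd (hr.trans_le hwF) this.not_gt
end

/-! ### Strongly exposed functionals and differentiability of the norm. -/

section
variable {𝕜 X : Type*} [RCLike 𝕜] [NormedAddCommGroup X] [NormedSpace 𝕜 X]

/-- Šmulian's test: at a point of Fréchet differentiability of the norm, the norming functional is
`w*`-strongly exposed. -/
theorem isWeakStarStronglyExposed_of_differentiableAt_norm [NormedSpace ℝ X] {x : X} (hx : x ≠ 0)
    (hd : DifferentiableAt ℝ (fun y : X => ‖y‖) x) {f : StrongDual 𝕜 X} (hf : ‖f‖ = 1)
    (hfx : f x = (‖x‖ : 𝕜)) : IsWeakStarStronglyExposed f := by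
  have hx0 : 0 < ‖x‖ := norm_pos_iff.2 hx
  have hxne : (‖x‖ : 𝕜) ≠ 0 := by exact_mod_cast hx0.ne'
  refine ⟨hf, (‖x‖ : 𝕜)⁻¹ • x, ?_, ?_, fun g hg hgu => ?_⟩
  · rw [norm_smul, norm_inv, RCLike.norm_ofReal, abs_of_pos hx0, inv_mul_cancel₀ hx0.ne']
  · rw [map_smul, hfx, smul_eq_mul, inv_mul_cancel₀ hxne]
  have hgx : ∀ n, RCLike.re (g n x) = ‖x‖ * RCLike.re (g n ((‖x‖ : 𝕜)⁻¹ • x)) := fun n => by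
    rw [← RCLike.re_ofReal_mul, ← smul_eq_mul, ← map_smul, smul_inv_smul₀ hxne]
  rw [Metric.tendsto_atTop']
  intro ε hε
  -- The `ε / 4` error enters twice, in `hupper` and `hLf`; dividing by `δ` leaves `ε / 2` in the
  -- limit.
  have hlo := (hasFDerivAt_iff_isLittleO_nhds_zero.1 hd.hasFDerivAt).def (show 0 < ε / 4 by positivity)
  set L := fderiv ℝ (fun y : X => ‖y‖) x
  obtain ⟨δ, hδ, hball⟩ := Metric.nhds_basis_closedBall.eventually_iff.1 hlo
  have hupper : ∀ h : X, ‖h‖ ≤ δ → ‖x + h‖ ≤ ‖x‖ + L h + ε / 4 * δ := fun h hh => by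
    have h1 := (le_abs_self _).trans (hball (mem_closedBall_zero_iff.2 hh))
    have h2 : ε / 4 * ‖h‖ ≤ ε / 4 * δ := by gcongr
    linarith
  have hLf : ∀ h : X, ‖h‖ ≤ δ → L h ≤ RCLike.re (f h) + ε / 4 * δ := fun h hh => by
    have h1 := hupper (-h) (by rwa [norm_neg])
    have h2 := StrongDual.re_apply_le_norm hf.le (x + -h)
    rw [map_add, map_neg, map_add, map_neg, hfx, RCLike.ofReal_re] at h2
    rw [map_neg] at h1
    linarith
  have hgf : ∀ n, ‖g n - f‖ ≤ (‖x‖ - RCLike.re (g n x) + ε / 2 * δ) / δ := fun n => by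
    refine ContinuousLinearMap.opNorm_bound_of_ball_bound hδ _ _ fun h hh => ?_
    obtain ⟨c, hc, hch⟩ := RCLike.exists_norm_eq_mul_self ((g n - f) h)
    have hch' : ‖c • h‖ ≤ δ := by
      rw [norm_smul, hc, one_mul]; exact mem_closedBall_zero_iff.1 hh
    have h1 := hupper (c • h) hch'
    have h2 := hLf (c • h) hch'
    have h3 := StrongDual.re_apply_le_norm (hg n) (x + c • h)
    have h4 : ‖(g n - f) h‖ = RCLike.re (g n (c • h)) - RCLike.re (f (c • h)) := by
      rw [← map_sub, ← sub_apply, map_smul, smul_eq_mul, ← hch, RCLike.ofReal_re]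
    rw [map_add, map_add] at h3
    linarith
  have hlim : Tendsto (fun n => (‖x‖ - RCLike.re (g n x) + ε / 2 * δ) / δ) atTop (𝓝 (ε / 2)) := by
    have h1 := (((hgu.const_mul ‖x‖).const_sub ‖x‖).add_const (ε / 2 * δ)).div_const δ
    have h2 : (‖x‖ - ‖x‖ * 1 + ε / 2 * δ) / δ = ε / 2 := by field_simp; ring
    rw [h2] at h1
    simpa only [hgx] using h1
  obtain ⟨N, hN⟩ := eventually_atTop.1 (hlim.eventually (gt_mem_nhds (half_lt_self hε)))
  refine ⟨N, fun n hn => ?_⟩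
  rw [Real.dist_eq, sub_zero, abs_norm]
  exact (hgf n).trans_lt (hN n hn.le)

/-- In an Asplund space the `w*`-strongly exposed functionals norm the space. -/
theorem IsAsplundSpace.exists_isWeakStarStronglyExposed [NormedSpace ℝ X] (hX : IsAsplundSpace X)
    {y : X} (hy : y ≠ 0) {c : ℝ} (hc : c < ‖y‖) :
    ∃ f : StrongDual 𝕜 X, IsWeakStarStronglyExposed f ∧ c < ‖f y‖ := by
  obtain ⟨G, -, -, hG, hd⟩ := hX Set.univ isOpen_univ Set.univ_nonempty (fun x => ‖x‖)
    (convexOn_norm convex_univ) continuous_norm.continuousOn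
  have hy0 : 0 < ‖y‖ := norm_pos_iff.2 hy
  obtain ⟨x, hxG, hxy⟩ := Metric.mem_closure_iff.1 (hG (Set.mem_univ y))
    -- Passing from `y` to `x` and back costs `2 ‖y - x‖`; the second bound keeps `x ≠ 0`.
    (min ((‖y‖ - c) / 2) ‖y‖) (lt_min (by linarith) hy0)
  rw [dist_eq_norm] at hxy
  have hx : x ≠ 0 := by
    rintro rfl
    rw [sub_zero] at hxy
    exact (hxy.trans_le (min_le_right _ _)).false
  obtain ⟨f, hf, hfx⟩ := exists_dual_vector 𝕜 x (norm_ne_zero_iff.2 hx)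
  refine ⟨f, isWeakStarStronglyExposed_of_differentiableAt_norm hx (hd x hxG) hf hfx, ?_⟩
  have h1 : ‖f (y - x)‖ ≤ ‖y - x‖ :=
    (f.le_of_opNorm_le_of_le hf.le le_rfl).trans_eq (one_mul _)
  have h2 : ‖f x‖ = ‖x‖ := by rw [hfx, RCLike.norm_ofReal, abs_norm]
  have h3 : ‖f x‖ ≤ ‖f y‖ + ‖f (y - x)‖ := by
    have := norm_sub_le (f y) (f (y - x))
    rwa [← map_sub, sub_sub_cancel] at this
  have h4 : ‖y‖ ≤ ‖x‖ + ‖y - x‖ := by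
    have := norm_add_le x (y - x)
    rwa [add_sub_cancel] at this
  have h5 := hxy.trans_le (min_le_left _ _)
  linarith

/-! ### Lumer's estimate and states of the bidual. -/

theorem norm_apply_le_numericalRadius (T : X →L[𝕜] X) {x : X} {f : StrongDual 𝕜 X} (hf : ‖f‖ = 1)
    (hx : ‖x‖ = 1) (hfx : f x = 1) : ‖f (T x)‖ ≤ numericalRadius T := by
  refine le_csSup ⟨‖T‖, ?_⟩ ⟨x, f, hf, hx, hfx, rfl⟩
  rintro r ⟨x, f, hf, hx, -, rfl⟩
  calc ‖f (T x)‖ ≤ 1 * ‖T x‖ := f.le_of_opNorm_le hf.le _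
    _ ≤ ‖T‖ := by rw [one_mul]; exact T.unit_le_opNorm x hx.le

theorem one_sub_numericalRadius_mul_norm_le (T : X →L[𝕜] X) (β : 𝕜) (x : X) :
    (1 - ‖β‖ * numericalRadius T) * ‖x‖ ≤ ‖x - β • T x‖ := by
  rcases eq_or_ne x 0 with rfl | hx
  · simp
  have hx0 : 0 < ‖x‖ := norm_pos_iff.2 hx
  have hxne : (‖x‖ : 𝕜) ≠ 0 := by exact_mod_cast hx0.ne'
  obtain ⟨f, hf, hfx⟩ := exists_dual_vector 𝕜 x (norm_ne_zero_iff.2 hx)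
  have h1 := norm_apply_le_numericalRadius T (x := (‖x‖ : 𝕜)⁻¹ • x) hf
    (by rw [norm_smul, norm_inv, RCLike.norm_ofReal, abs_of_pos hx0, inv_mul_cancel₀ hx0.ne'])
    (by rw [map_smul, hfx, smul_eq_mul, inv_mul_cancel₀ hxne])
  rw [map_smul, map_smul, norm_smul, norm_inv, RCLike.norm_ofReal, abs_norm,
    inv_mul_le_iff₀ hx0] at h1
  have h2 : ‖f (x - β • T x)‖ ≤ ‖x - β • T x‖ :=
    (f.le_of_opNorm_le hf.le _).trans_eq (one_mul _)
  have h3 : ‖f x‖ - ‖β‖ * ‖f (T x)‖ ≤ ‖f (x - β • T x)‖ := by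
    rw [map_sub, map_smul, smul_eq_mul, ← norm_mul]
    exact norm_sub_norm_le _ _
  rw [hfx, RCLike.norm_ofReal, abs_norm] at h3
  have h4 : ‖β‖ * ‖f (T x)‖ ≤ ‖β‖ * (‖x‖ * numericalRadius T) := by gcongr
  linarith

/-- Lumer's estimate of `‖Id + β T‖` by the numerical radius. -/
theorem one_sub_mul_norm_id_add_smul_le (T : X →L[𝕜] X) {β : 𝕜}
    (hβ : ‖β‖ * numericalRadius T < 1) :
    (1 - ‖β‖ * numericalRadius T) * ‖ContinuousLinearMap.id 𝕜 X + β • T‖ ≤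
      1 + ‖β‖ ^ 2 * ‖T‖ ^ 2 := by
  have hpos : 0 < 1 - ‖β‖ * numericalRadius T := by linarith
  rw [mul_comm, ← le_div_iff₀ hpos]
  refine ContinuousLinearMap.opNorm_le_bound _ (by positivity) fun x => ?_
  rw [div_mul_eq_mul_div, le_div_iff₀ hpos, mul_comm]
  refine (one_sub_numericalRadius_mul_norm_le T β _).trans ?_
  -- `(Id - β T)(Id + β T) = Id - β² T²` leaves only a second-order term.
  have h : (ContinuousLinearMap.id 𝕜 X + β • T) x - β • T ((ContinuousLinearMap.id 𝕜 X + β • T) x)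
      = x - (β * β) • T (T x) := by
    simp only [add_apply, smul_apply, ContinuousLinearMap.id_apply, map_add, map_smul, smul_add,
      smul_smul]
    abel
  rw [h]
  calc ‖x - (β * β) • T (T x)‖ ≤ ‖x‖ + ‖(β * β) • T (T x)‖ := norm_sub_le _ _
    _ ≤ ‖x‖ + ‖β‖ ^ 2 * (‖T‖ * (‖T‖ * ‖x‖)) := by
      rw [norm_smul, norm_mul, ← sq]
      gcongr
      exact T.le_opNorm_of_le (T.le_opNorm x)
    _ = (1 + ‖β‖ ^ 2 * ‖T‖ ^ 2) * ‖x‖ := by ring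

/-- States of the bidual do not increase the numerical radius. -/
theorem norm_apply_comp_le_numericalRadius (T : X →L[𝕜] X) {f : StrongDual 𝕜 X} (hf : ‖f‖ = 1)
    {F : StrongDual 𝕜 (StrongDual 𝕜 X)} (hF : ‖F‖ ≤ 1) (hFf : ‖F f‖ = 1) :
    ‖F (f.comp T)‖ ≤ numericalRadius T := by
  set K := numericalRadius T
  have hK : 0 ≤ K := numericalRadius_nonneg T
  set z := F (f.comp T)
  obtain ⟨a, ha, haz⟩ := RCLike.exists_norm_eq_mul_self z
  have key : ∀ t : ℝ, 0 < t → t * K < 1 → (1 - t * K) * (1 + t * ‖z‖) ≤ 1 + t ^ 2 * ‖T‖ ^ 2 := by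
    intro t ht htK
    -- This phase aligns `β z` with `F f`, so `F (f ∘ (Id + β T))` has modulus `1 + t ‖z‖`.
    set β : 𝕜 := t * (F f * a)
    have hβ : ‖β‖ = t := by
      rw [norm_mul, norm_mul, hFf, ha, RCLike.norm_ofReal, abs_of_pos ht, mul_one, mul_one]
    have h1 := one_sub_mul_norm_id_add_smul_le T (β := β) (by rwa [hβ])
    rw [hβ] at h1
    refine (mul_le_mul_of_nonneg_left ?_ (by linarith)).trans h1
    have h2 : F (f.comp (ContinuousLinearMap.id 𝕜 X + β • T)) = F f * ((1 + t * ‖z‖ : ℝ) : 𝕜) := by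
      rw [ContinuousLinearMap.comp_add, ContinuousLinearMap.comp_smul, map_add, map_smul,
        ContinuousLinearMap.comp_id, smul_eq_mul]
      change F f + β * z = _
      have haz' : (‖z‖ : 𝕜) = a * z := haz
      rw [RCLike.ofReal_add, RCLike.ofReal_mul, RCLike.ofReal_one, haz']
      simp only [β]
      ring
    have h3 : ‖F f * ((1 + t * ‖z‖ : ℝ) : 𝕜)‖ = 1 + t * ‖z‖ := by
      rw [norm_mul, hFf, one_mul, RCLike.norm_ofReal, abs_of_nonneg (by positivity)]
    rw [← h3, ← h2]
    calc _ ≤ 1 * ‖f.comp (ContinuousLinearMap.id 𝕜 X + β • T)‖ := F.le_of_opNorm_le hF _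
      _ ≤ 1 * (‖f‖ * ‖ContinuousLinearMap.id 𝕜 X + β • T‖) := by
        gcongr; exact ContinuousLinearMap.opNorm_comp_le _ _
      _ = _ := by rw [hf, one_mul, one_mul]
  by_contra! hlt
  have hd : 0 < ‖z‖ - K := by linarith
  have hA : 0 ≤ ‖T‖ ^ 2 + K * ‖z‖ := by positivity
  have hKd : 0 ≤ K * (‖z‖ - K) := mul_nonneg hK hd.le
  have hM : 0 < ‖T‖ ^ 2 + K * ‖z‖ + 1 + K * (‖z‖ - K) := by linarith
  -- `key` reads `t (‖z‖ - K) ≤ t² (‖T‖² + K ‖z‖)`, which fails for small `t` if `‖z‖ > K`.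
  obtain ⟨t, ht, htK, htA⟩ : ∃ t : ℝ, 0 < t ∧ t * K < 1 ∧ t * (‖T‖ ^ 2 + K * ‖z‖) < ‖z‖ - K := by
    refine ⟨(‖z‖ - K) / (‖T‖ ^ 2 + K * ‖z‖ + 1 + K * (‖z‖ - K)), div_pos hd hM, ?_, ?_⟩
    · rw [div_mul_eq_mul_div, div_lt_one hM]
      linarith
    · rw [div_mul_eq_mul_div, div_lt_iff₀ hM]
      exact mul_lt_mul_of_pos_left (by linarith) hd
  have h1 := key t ht htK
  have h2 := mul_lt_mul_of_pos_left htA ht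
  linarith

/-! ### The implications. -/

theorem numericalIndex_eq_one_iff [Nontrivial X] :
    numericalIndex 𝕜 X = 1 ↔ ∀ T : X →L[𝕜] X, ‖T‖ ≤ numericalRadius T := by
  have h := isGreatest_numericalIndex 𝕜 X
  refine ⟨fun h1 T => by simpa [h1] using h.1.2 T, fun h1 => le_antisymm ?_ ?_⟩
  · have h2 := (h.1.2 (ContinuousLinearMap.id 𝕜 X)).trans (numericalRadius_le_norm _)
    simpa [ContinuousLinearMap.norm_id] using h2
  · exact h.2 ⟨zero_le_one, fun T => by simpa using h1 T⟩

theorem hasAlternativeDaugavetProperty_of_norm_le_numericalRadius [Nontrivial X]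
    (h : ∀ T : X →L[𝕜] X, ‖T‖ ≤ numericalRadius T) : HasAlternativeDaugavetProperty 𝕜 X := by
  intro T _
  have hcont : Continuous fun ω : 𝕜 => ‖ContinuousLinearMap.id 𝕜 X + ω • T‖ := by fun_prop
  have hup : ∀ ω : 𝕜, ‖ω‖ = 1 → ‖ContinuousLinearMap.id 𝕜 X + ω • T‖ ≤ 1 + ‖T‖ := fun ω hω =>
    (norm_add_le _ _).trans (by rw [ContinuousLinearMap.norm_id, norm_smul, hω, one_mul])
  obtain ⟨ω, hω, hmax⟩ := (isCompact_sphere (0 : 𝕜) 1).exists_isMaxOn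
    ⟨1, by simp⟩ hcont.continuousOn
  have hstate : ∀ (x : X) (f : StrongDual 𝕜 X), ‖f‖ = 1 → ‖x‖ = 1 → f x = 1 →
      ‖f (T x)‖ ≤ ‖ContinuousLinearMap.id 𝕜 X + ω • T‖ - 1 := by
    intro x f hf hx hfx
    -- With this phase `f ((Id + c T) x) = 1 + |f (T x)|`.
    obtain ⟨c, hc, hcz⟩ := RCLike.exists_norm_eq_mul_self (f (T x))
    have h1 : ‖ContinuousLinearMap.id 𝕜 X + c • T‖ ≤ ‖ContinuousLinearMap.id 𝕜 X + ω • T‖ :=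
      hmax (show c ∈ sphere (0 : 𝕜) 1 by simpa using hc)
    have h2 : f ((ContinuousLinearMap.id 𝕜 X + c • T) x) = ((1 + ‖f (T x)‖ : ℝ) : 𝕜) := by
      have hcz' : (‖f (T x)‖ : 𝕜) = c * f (T x) := hcz
      rw [add_apply, smul_apply, ContinuousLinearMap.id_apply, map_add, map_smul, hfx, smul_eq_mul]
      rw [RCLike.ofReal_add, RCLike.ofReal_one, hcz']
    have h3 : ‖f ((ContinuousLinearMap.id 𝕜 X + c • T) x)‖ = 1 + ‖f (T x)‖ := by
      rw [h2, RCLike.norm_ofReal, abs_of_nonneg (by positivity)]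
    have h4 : ‖f ((ContinuousLinearMap.id 𝕜 X + c • T) x)‖ ≤
        ‖ContinuousLinearMap.id 𝕜 X + c • T‖ :=
      (f.le_of_opNorm_le hf.le _).trans (by
        rw [one_mul]; exact ContinuousLinearMap.unit_le_opNorm _ x hx.le)
    linarith
  let _ : NormedSpace ℝ X := NormedSpace.restrictScalars ℝ 𝕜 X
  obtain ⟨x, hx⟩ := exists_norm_eq X zero_le_one
  obtain ⟨f, hf, hfx⟩ := exists_dual_vector 𝕜 x (by rw [hx]; exact one_ne_zero)
  rw [hx, RCLike.ofReal_one] at hfx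
  have hlow : numericalRadius T ≤ ‖ContinuousLinearMap.id 𝕜 X + ω • T‖ - 1 := by
    refine csSup_le ⟨_, x, f, hf, hx, hfx, rfl⟩ ?_
    rintro r ⟨x, f, hf, hx, hfx, rfl⟩
    exact hstate x f hf hx hfx
  refine ⟨⟨ω, hω, le_antisymm (hup ω (by simpa using hω)) ?_⟩, ?_⟩
  · change 1 + ‖T‖ ≤ ‖ContinuousLinearMap.id 𝕜 X + ω • T‖
    linarith [h T]
  · rintro _ ⟨c, hc, rfl⟩
    exact hup c (by simpa using hc)

/-- Under the alternative Daugavet property, a `w*`-strongly exposed functional `f` satisfies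
`‖f + ω g‖ = 1 + ‖g‖` for every functional `g` and some unimodular `ω`. -/
theorem HasAlternativeDaugavetProperty.exists_le_norm_add_smul
    (h : HasAlternativeDaugavetProperty 𝕜 X) {f : StrongDual 𝕜 X}
    (hf : IsWeakStarStronglyExposed f) (g : StrongDual 𝕜 X) :
    ∃ ω : 𝕜, ‖ω‖ = 1 ∧ 1 + ‖g‖ ≤ ‖f + ω • g‖ := by
  obtain ⟨hf1, u, hu, hfu, hexp⟩ := hf
  rcases eq_or_ne g 0 with rfl | hg
  · exact ⟨1, norm_one, by simp [hf1]⟩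
  have hg0 : 0 < ‖g‖ := norm_pos_iff.2 hg
  have hu0 : u ≠ 0 := by
    rintro rfl
    simp at hfu
  have hu1 : ‖u‖ = 1 := by
    refine le_antisymm hu ?_
    have := f.le_opNorm u
    rwa [hfu, hf1, norm_one, one_mul] at this
  set T : X →L[𝕜] X := g.smulRight u
  have hT : ‖T‖ = ‖g‖ := by
    rw [ContinuousLinearMap.norm_smulRight_apply, hu1, mul_one]
  have hrank : Module.finrank 𝕜 (LinearMap.range (T : X →ₗ[𝕜] X)) = 1 := by
    have : LinearMap.range (T : X →ₗ[𝕜] X) = Submodule.span 𝕜 {u} := by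
      ext y
      rw [LinearMap.mem_range, Submodule.mem_span_singleton]
      constructor
      · rintro ⟨x, rfl⟩
        exact ⟨g x, rfl⟩
      · rintro ⟨a, rfl⟩
        obtain ⟨v, hv⟩ : ∃ v, g v ≠ 0 := by
          by_contra! hall
          exact hg (ContinuousLinearMap.ext hall)
        refine ⟨(a / g v) • v, ?_⟩
        change g ((a / g v) • v) • u = a • u
        rw [map_smul, smul_eq_mul, div_mul_cancel₀ _ hv]
    rw [this, finrank_span_singleton hu0]
  obtain ⟨ω, hω, hωT⟩ := (h T hrank).1
  have hω1 : ‖ω‖ = 1 := by simpa using hω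
  rw [hT] at hωT
  replace hωT : ‖ContinuousLinearMap.id 𝕜 X + ω • T‖ = 1 + ‖g‖ := hωT
  refine ⟨ω, hω1, ?_⟩
  -- `k` norms `(Id + ω T) x` for an almost norming `x`, and `k ((Id + ω T) x) = (k + ω k(u) g) x`;
  -- a rotation then makes `k u ≥ 0`.
  have happrox : ∀ ε > 0, ∃ k : StrongDual 𝕜 X, ‖k‖ ≤ 1 ∧ k u = (‖k u‖ : 𝕜) ∧
      1 + ‖g‖ - ε ≤ ‖k + (ω * k u) • g‖ := by
    intro ε hε
    obtain ⟨k, hk, hkn⟩ : ∃ k : StrongDual 𝕜 X, ‖k‖ ≤ 1 ∧ 1 + ‖g‖ - ε ≤ ‖k + (ω * k u) • g‖ := by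
      obtain ⟨x, hx, hxT⟩ : ∃ x : X, ‖x‖ < 1 ∧
          1 + ‖g‖ - ε < ‖(ContinuousLinearMap.id 𝕜 X + ω • T) x‖ :=
        ContinuousLinearMap.exists_lt_apply_of_lt_opNorm _ (by linarith)
      obtain ⟨k, hk, hkx⟩ := exists_dual_vector'' 𝕜 ((ContinuousLinearMap.id 𝕜 X + ω • T) x)
      refine ⟨k, hk, ?_⟩
      have h1 : (k + (ω * k u) • g) x = k ((ContinuousLinearMap.id 𝕜 X + ω • T) x) := by
        simp only [add_apply, smul_apply, ContinuousLinearMap.id_apply, map_add, map_smul, T,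
          ContinuousLinearMap.smulRight_apply, smul_eq_mul]
        ring
      have h2 := (k + (ω * k u) • g).unit_le_opNorm x hx.le
      rw [h1, hkx, RCLike.norm_ofReal, abs_norm] at h2
      linarith
    obtain ⟨c, hc, hcz⟩ := RCLike.exists_norm_eq_mul_self (k u)
    refine ⟨c • k, by rwa [norm_smul, hc, one_mul], ?_, ?_⟩
    · rw [smul_apply, norm_smul, hc, one_mul, smul_eq_mul]
      exact hcz.symm
    · have h1 : c • k + (ω * (c • k) u) • g = c • (k + (ω * k u) • g) := by
        rw [smul_apply, smul_add, smul_smul, smul_eq_mul, mul_left_comm]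
      rwa [h1, norm_smul, hc, one_mul]
  choose k hk hku hkn using fun n : ℕ => happrox (1 / ((n : ℝ) + 1)) (by positivity)
  have hε := tendsto_one_div_add_atTop_nhds_zero_nat (𝕜 := ℝ)
  have hkle : ∀ n, ‖k n u‖ ≤ 1 := fun n =>
    ((k n).le_of_opNorm_le_of_le (hk n) hu).trans_eq (one_mul _)
  -- Near-equality in the triangle inequality forces `|k n u| → 1`, so strong exposedness gives `k n
  -- → f` in norm.
  have hlow : ∀ n : ℕ, 1 - 1 / ((n : ℝ) + 1) / ‖g‖ ≤ ‖k n u‖ := fun n => by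
    have h1 := norm_add_le (k n) ((ω * k n u) • g)
    rw [norm_smul, norm_mul, hω1, one_mul] at h1
    have h2 := hkn n
    have h3 := hk n
    have h4 : ‖g‖ - 1 / ((n : ℝ) + 1) ≤ ‖k n u‖ * ‖g‖ := by linarith
    rwa [← div_le_iff₀ hg0, sub_div, div_self hg0.ne'] at h4
  have hnorm : Tendsto (fun n => ‖k n u‖) atTop (𝓝 1) := by
    refine tendsto_of_tendsto_of_tendsto_of_le_of_le ?_ tendsto_const_nhds hlow hkle
    simpa using (hε.div_const ‖g‖).const_sub 1
  have hku1 : Tendsto (fun n => k n u) atTop (𝓝 1) := by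
    have h1 := (RCLike.continuous_ofReal (K := 𝕜)).continuousAt.tendsto.comp hnorm
    rw [RCLike.ofReal_one] at h1
    exact h1.congr fun n => (hku n).symm
  have hkf : Tendsto k atTop (𝓝 f) := by
    rw [tendsto_iff_norm_sub_tendsto_zero]
    refine hexp k hk ?_
    have h1 := (RCLike.continuous_re.tendsto (1 : 𝕜)).comp hku1
    rwa [RCLike.one_re] at h1
  have hlim : Tendsto (fun n => ‖k n + (ω * k n u) • g‖) atTop (𝓝 ‖f + ω • g‖) := by
    have h1 := (hkf.add ((hku1.const_mul ω).smul_const g)).norm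
    rwa [mul_one] at h1
  have hlim' : Tendsto (fun n : ℕ => 1 + ‖g‖ - 1 / ((n : ℝ) + 1)) atTop (𝓝 (1 + ‖g‖)) := by
    simpa using hε.const_sub (1 + ‖g‖)
  exact le_of_tendsto_of_tendsto' hlim' hlim hkn

theorem norm_le_numericalRadius_of_norm_apply_eq_one [NormedSpace ℝ X] (hX : IsAsplundSpace X)
    (h : ∀ F ∈ (closedBall (0 : StrongDual 𝕜 (StrongDual 𝕜 X)) 1).extremePoints ℝ,
      ∀ f : StrongDual 𝕜 X, IsWeakStarStronglyExposed f → ‖F f‖ = 1) (T : X →L[𝕜] X) :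
    ‖T‖ ≤ numericalRadius T := by
  refine T.opNorm_le_bound (numericalRadius_nonneg T) fun x => ?_
  by_contra! hlt
  have hTx : T x ≠ 0 := norm_pos_iff.1
    ((mul_nonneg (numericalRadius_nonneg T) (norm_nonneg x)).trans_lt hlt)
  obtain ⟨f, hf, hfx⟩ := hX.exists_isWeakStarStronglyExposed (𝕜 := 𝕜) hTx hlt
  obtain ⟨F, hF, hFe⟩ := exists_extremePoint_re_apply_eq_norm (𝕜 := 𝕜) (f.comp T)
  have h1 := norm_apply_comp_le_numericalRadius T hf.1 (mem_closedBall_zero_iff.1 hF.1)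
    (h F hF f hf)
  have h2 := (RCLike.re_le_norm (F (f.comp T))).trans h1
  rw [hFe] at h2
  exact absurd ((f.comp T).le_of_opNorm_le h2 x) hfx.not_ge
end

theorem mainTheorem9 {𝕜 X : Type*} [RCLike 𝕜] [NormedAddCommGroup X] [NormedSpace 𝕜 X]
    [NormedSpace ℝ X] [IsScalarTower ℝ 𝕜 X] [CompleteSpace X] [Nontrivial X]
    (hX : IsAsplundSpace X) :
    List.TFAE [
      numericalIndex 𝕜 X = 1,
      HasAlternativeDaugavetProperty 𝕜 X,
      ∀ F ∈ (closedBall (0 : StrongDual 𝕜 (StrongDual 𝕜 X)) 1).extremePoints ℝ,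
        ∀ f : StrongDual 𝕜 X, IsWeakStarStronglyExposed f → ‖F f‖ = 1] := by
  tfae_have 1 → 2 := fun h =>
    hasAlternativeDaugavetProperty_of_norm_le_numericalRadius (numericalIndex_eq_one_iff.1 h)
  tfae_have 2 → 3 := fun h F hF f hf =>
    norm_apply_eq_one_of_mem_extremePoints hf.1 (h.exists_le_norm_add_smul hf) hF
  tfae_have 3 → 1 := fun h => numericalIndex_eq_one_iff.2
    (norm_le_numericalRadius_of_norm_apply_eq_one hX h)
  tfae_finish
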